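/- Theorem 3.15. Let $R$ be a commutative Artinian ring and let $\Lambda$ be an Artin $R$-algebra, i.e. an $R$-algebra that is finitely generated as an $R$-module. Let $r$ be the Jacobson radical of $\Lambda$ and suppose that $r^2=0$. All modules are finitely generated left $\Lambda$-modules. For a module $X$ let $P_1(X)\to P_0(X)\to X\to 0$ be the first two terms of a minimal projective resolution of $X$, let $\operatorname{Tr}X$ be the cokernel of the induced map $\operatorname{Hom}_\Lambda(P_0(X),\Lambda)\to\operatorname{Hom}_\Lambda(P_1(X),\Lambda)$ of right $\Lambda$-modules, and let $\tau X=\operatorname{Hom}_R(\operatorname{Tr}X,I)$ be the Auslander–Reiten translate, where $I$ is an injective envelope of the $R$-module $R/\operatorname{rad}R$. Call $X$ $\tau$-rigid if $\operatorname{Hom}_\Lambda(X,\tau X)=0$. Let $M$ be an indecomposable $\Lambda$-module such that $\tau M$ is $\tau$-rigid. Then $M$ is $\tau$-rigid if and only if $P_0(M)$ and $P_1(M)$ have no non-zero direct summand in common up to isomorphism, i.e. no non-zero direct summand of $P_0(M)$ is isomorphic to a direct summand of $P_1(M)$. -/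

import Mathlib

universe u v w

namespace ArtinAlg

section Modules

variable {Λ : Type v} [Ring Λ]

/-- `Λ` has radical square zero: every product of two elements of the Jacobson radical vanishes. -/
def RadicalSquareZero (Λ : Type v) [Ring Λ] : Prop :=
  ∀ a ∈ Ring.jacobson Λ, ∀ b ∈ Ring.jacobson Λ, a * b = 0

/-- A non-zero module in which every direct sum decomposition is trivial. -/
def IsIndecomposable (Λ : Type v) [Ring Λ] (M : Type w) [AddCommGroup M] [Module Λ M] : Prop :=
  Nontrivial M ∧ ∀ X Y : Submodule Λ M, IsCompl X Y → X = ⊥ ∨ Y = ⊥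

/-- A submodule `N` of `P` is superfluous (small) if `N + X = P` only for `X = P`. -/
def IsSuperfluous {P : Type w} [AddCommGroup P] [Module Λ P] (N : Submodule Λ P) : Prop :=
  ∀ X : Submodule Λ P, N ⊔ X = ⊤ → X = ⊤

/-- `P` and `Q` have a non-zero direct summand in common (up to isomorphism). -/
def HaveCommonSummand (Λ : Type v) [Ring Λ] (P Q : Type w) [AddCommGroup P] [Module Λ P]
    [AddCommGroup Q] [Module Λ Q] : Prop :=
  ∃ (X : Submodule Λ P) (Y : Submodule Λ Q),
    X ≠ ⊥ ∧ IsComplemented X ∧ IsComplemented Y ∧ Nonempty (X ≃ₗ[Λ] Y)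

/-- The first two terms `P₁ → P₀ → M → 0` of a minimal projective resolution of `M` by finitely
generated projective modules: `P₀ → M` is a projective cover of `M`, and `P₁ → P₀` induces a
projective cover of the first syzygy `ker (P₀ → M)`. -/
structure MinProjPres (Λ : Type v) [Ring Λ] (M : Type w) [AddCommGroup M] [Module Λ M] where
  P₀ : Type v
  P₁ : Type v
  [addCommGroup₀ : AddCommGroup P₀]
  [addCommGroup₁ : AddCommGroup P₁]
  [module₀ : Module Λ P₀]
  [module₁ : Module Λ P₁]
  [finite₀ : Module.Finite Λ P₀]
  [finite₁ : Module.Finite Λ P₁]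
  [projective₀ : Module.Projective Λ P₀]
  [projective₁ : Module.Projective Λ P₁]
  /-- the augmentation `P₀ → M` -/
  π : P₀ →ₗ[Λ] M
  /-- the differential `P₁ → P₀` -/
  d : P₁ →ₗ[Λ] P₀
  surjective_π : Function.Surjective π
  exact : LinearMap.range d = LinearMap.ker π
  superfluous_ker_π : IsSuperfluous (LinearMap.ker π)
  superfluous_ker_d : IsSuperfluous (LinearMap.ker d)

attribute [instance] MinProjPres.addCommGroup₀ MinProjPres.addCommGroup₁ MinProjPres.module₀
  MinProjPres.module₁ MinProjPres.finite₀ MinProjPres.finite₁ MinProjPres.projective₀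
  MinProjPres.projective₁

/-- For a map `d : P → Q` of left `Λ`-modules, the map `d^* : Q^* → P^*`, `g ↦ g ∘ d`, of right
`Λ`-modules, where `X^* = Hom_Λ(X, Λ)`. -/
def starMap {P Q : Type w} [AddCommGroup P] [Module Λ P] [AddCommGroup Q] [Module Λ Q]
    (d : P →ₗ[Λ] Q) : (Q →ₗ[Λ] Λ) →ₗ[Λᵐᵒᵖ] (P →ₗ[Λ] Λ) where
  toFun g := g ∘ₗ d
  map_add' _ _ := rfl
  map_smul' _ _ := rfl

/-- The Auslander–Bridger transpose `Tr M = coker (P₀^* → P₁^*)`, a right `Λ`-module. -/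
abbrev MinProjPres.Tr {M : Type w} [AddCommGroup M] [Module Λ M] (p : MinProjPres Λ M) : Type v :=
  (p.P₁ →ₗ[Λ] Λ) ⧸ LinearMap.range (starMap p.d)

end Modules

section Duality

/-- `I` is an injective envelope of the `R`-module `N`: it is injective, and it contains a copy
of `N` which meets every non-zero submodule of `I`. -/
def IsInjectiveEnvelope (R : Type u) [CommRing R] (N I : Type u) [AddCommGroup N] [Module R N]
    [AddCommGroup I] [Module R I] : Prop :=
  Module.Injective R I ∧ ∃ ι : N →ₗ[R] I, Function.Injective ι ∧
    ∀ X : Submodule R I, LinearMap.range ι ⊓ X = ⊥ → X = ⊥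

/-- `D X = Hom_R(X, I)` for a right `Λ`-module `X`, to be regarded as a left `Λ`-module. -/
def Dual (R : Type u) (Λ : Type v) (I : Type u) (X : Type w) [CommRing R] [Ring Λ] [Algebra R Λ]
    [AddCommGroup I] [Module R I] [AddCommGroup X] [Module R X] [Module Λᵐᵒᵖ X]
    [IsScalarTower R Λᵐᵒᵖ X] : Type (max w u) :=
  X →ₗ[R] I

variable {R : Type u} {Λ : Type v} {I : Type u} {X : Type w} [CommRing R] [Ring Λ] [Algebra R Λ]
  [AddCommGroup I] [Module R I] [AddCommGroup X] [Module R X] [Module Λᵐᵒᵖ X]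
  [IsScalarTower R Λᵐᵒᵖ X]

instance Dual.instAddCommGroup : AddCommGroup (Dual R Λ I X) :=
  inferInstanceAs (AddCommGroup (X →ₗ[R] I))

/-- The left `Λ`-module structure `(a φ)(x) = φ(x a)` on `D X`. -/
instance Dual.instModule : Module Λ (Dual R Λ I X) where
  smul a φ :=
    { toFun := fun x => (show X →ₗ[R] I from φ) (MulOpposite.op a • x)
      map_add' := fun x y => by rw [smul_add, map_add]
      map_smul' := fun c x => by
        rw [RingHom.id_apply, ← map_smul, smul_algebra_smul_comm] }
  one_smul φ := LinearMap.ext fun x =>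
    congrArg (show X →ₗ[R] I from φ) (one_smul Λᵐᵒᵖ x)
  mul_smul a b φ := LinearMap.ext fun x =>
    congrArg (show X →ₗ[R] I from φ) (mul_smul (MulOpposite.op b) (MulOpposite.op a) x)
  smul_zero _ := LinearMap.ext fun _ => rfl
  smul_add _ _ _ := LinearMap.ext fun _ => rfl
  add_smul a b φ := LinearMap.ext fun x =>
    (congrArg (show X →ₗ[R] I from φ)
      (add_smul (MulOpposite.op a) (MulOpposite.op b) x)).trans (map_add _ _ _)
  zero_smul φ := LinearMap.ext fun x =>
    (congrArg (show X →ₗ[R] I from φ) (zero_smul Λᵐᵒᵖ x)).trans (map_zero _)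

/-- The Auslander–Reiten translate `τ M = D Tr M`, computed from the first two terms of a minimal
projective resolution of `M`. -/
abbrev MinProjPres.tau (R : Type u) (I : Type u) {Λ : Type v} [CommRing R] [Ring Λ] [Algebra R Λ]
    [AddCommGroup I] [Module R I] {M : Type w} [AddCommGroup M] [Module Λ M]
    (p : MinProjPres Λ M) : Type (max v u) :=
  Dual R Λ I p.Tr

/-- `M` is `τ`-rigid: `Hom_Λ(M, τ M) = 0`. (A minimal projective resolution of `M`, and with it
`τ M`, is unique up to isomorphism, so the choice of `p` does not matter.) -/
def IsTauRigid (R : Type u) (I : Type u) (Λ : Type v) [CommRing R] [Ring Λ] [Algebra R Λ]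
    [AddCommGroup I] [Module R I] (M : Type w) [AddCommGroup M] [Module Λ M] : Prop :=
  ∃ p : MinProjPres Λ M, ∀ f : M →ₗ[Λ] p.tau R I, f = 0

end Duality

end ArtinAlg

/-! Write `P₁ → P₀ → M` for the minimal presentation, with maps `d` and `π`. A functional on the
cokernel of Hom(P₀, M) → Hom(P₁, M) yields a map `M → τM`, so τ-rigidity forces every map `P₁ → M`
to factor through `d` (`factorsThrough_of_forall_eq_zero`). A common summand would give a map `P₁ →
P₀` whose image contains a nonzero summand of `P₀`, yet this factorization confines the image to a
superfluous submodule.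

Conversely, let `f : M → τM`. Rigidity of `τM` makes the induced map `τM → ττM` zero, so `f` factors
through the projective cover of `τM` (`exists_π_comp_eq`). If `M` is not projective,
indecomposability puts the image of `M` inside the radical of that cover, and `r² = 0` gives `r •
f(M) = 0`. Without common summands every map `P₁ → P₀` lands in the radical, which forces such an
`f` to vanish (`eq_zero_of_jacobson_smul`). If `M` is projective, `P₁ = 0` and `τM = 0`. -/

namespace ArtinAlg

/-! ### Fitting's lemma, projective summands and radicals -/

section FiniteLength

variable {Λ : Type*} [Ring Λ]

/-- Lifting along a map `d` of a map from a projective module with values in the range of `d`. -/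
theorem exists_comp_eq_of_range_le {P Q₁ Q₀ : Type*} [AddCommGroup P] [Module Λ P]
    [AddCommGroup Q₁] [Module Λ Q₁] [AddCommGroup Q₀] [Module Λ Q₀] [Module.Projective Λ P]
    (d : Q₁ →ₗ[Λ] Q₀) (g : P →ₗ[Λ] Q₀) (h : LinearMap.range g ≤ LinearMap.range d) :
    ∃ k : P →ₗ[Λ] Q₁, d ∘ₗ k = g := by
  obtain ⟨k, hk⟩ := Module.projective_lifting_property d.rangeRestrict
    (g.codRestrict (LinearMap.range d) fun x => h ⟨x, rfl⟩) d.surjective_rangeRestrict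
  refine ⟨k, LinearMap.ext fun x => ?_⟩
  exact congrArg Subtype.val (LinearMap.congr_fun hk x)

theorem exists_dualBasis (P : Type*) [AddCommGroup P] [Module Λ P] [Module.Finite Λ P]
    [Module.Projective Λ P] :
    ∃ (n : ℕ) (g : Fin n → P →ₗ[Λ] Λ) (y : Fin n → P), ∀ x, ∑ i, g i x • y i = x := by
  obtain ⟨n, f, g, -, -, h⟩ := Module.Finite.exists_comp_eq_id_of_projective Λ P
  refine ⟨n, fun i => LinearMap.proj i ∘ₗ g, fun i => f (Pi.single i 1), fun x => ?_⟩
  have hx : f (g x) = x := LinearMap.congr_fun h x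
  conv_rhs => rw [← hx, pi_eq_sum_univ' (g x)]
  simp only [map_sum, LinearMap.comp_apply, LinearMap.proj_apply]
  refine Finset.sum_congr rfl fun i _ => ?_
  rw [← map_smul]

/-- Among the direct summands of `P` on which `q` does not vanish there is one whose endomorphisms
over `q` are all bijective. -/
theorem exists_isComplemented_minimal {P S : Type*} [AddCommGroup P] [Module Λ P]
    [AddCommGroup S] [Module Λ S] [IsNoetherian Λ P] [IsArtinian Λ P] (q : P →ₗ[Λ] S)
    (hq : q ≠ 0) :
    ∃ X : Submodule Λ P, IsComplemented X ∧ q.domRestrict X ≠ 0 ∧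
      ∀ h : X →ₗ[Λ] X, q.domRestrict X ∘ₗ h = q.domRestrict X → Function.Bijective h := by
  obtain ⟨X, ⟨⟨X', hX⟩, hqX⟩, hmin⟩ := wellFounded_lt.has_min
    {X : Submodule Λ P | IsComplemented X ∧ q.domRestrict X ≠ 0}
    ⟨⊤, isComplemented_top, fun h => hq (LinearMap.ext fun x =>
      LinearMap.congr_fun h ⟨x, trivial⟩)⟩
  refine ⟨X, ⟨X', hX⟩, hqX, fun h hh => ?_⟩
  have hpow : ∀ n : ℕ, q.domRestrict X ∘ₗ (h ^ n) = q.domRestrict X := by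
    intro n
    induction n with
    | zero => rfl
    | succ n ih => rw [pow_succ, Module.End.mul_eq_comp, ← LinearMap.comp_assoc, ih, hh]
  obtain ⟨n, hn⟩ := Filter.eventually_atTop.mp
    (LinearMap.eventually_isCompl_ker_pow_range_pow (M := X) h)
  -- Fitting decomposition: the range of `h ^ (n + 1)` is a summand on which `q` is still nonzero,
  -- so minimality makes it `X`. The positive exponent then makes `h` itself onto.
  replace hn := hn (n + 1) (by omega)
  set Z := LinearMap.range (h ^ (n + 1)) with hZ
  have hZle : Z.map X.subtype ≤ X := Submodule.map_subtype_le X Z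
  have hcompl : IsComplemented (Z.map X.subtype) := by
    refine ⟨(LinearMap.ker (h ^ (n + 1))).map X.subtype ⊔ X', ?_, ?_⟩
    · refine Disjoint.disjoint_sup_right_of_disjoint_sup_left ?_ ?_
      · exact (Submodule.disjoint_map X.injective_subtype hn.disjoint).symm
      · rw [← Submodule.map_sup, sup_comm Z, hn.sup_eq_top, Submodule.map_subtype_top]
        exact hX.disjoint
    · rw [codisjoint_iff, ← sup_assoc, ← Submodule.map_sup, sup_comm Z, hn.sup_eq_top,
        Submodule.map_subtype_top, hX.sup_eq_top]
  have hne : q.domRestrict (Z.map X.subtype) ≠ 0 := by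
    intro h0
    apply hqX
    rw [← hpow (n + 1)]
    ext x
    exact LinearMap.congr_fun h0 ⟨_, Submodule.mem_map_of_mem ⟨x, rfl⟩⟩
  have heq : Z.map X.subtype = X := by
    by_contra hcon
    exact hmin _ ⟨hcompl, hne⟩ (lt_of_le_of_ne hZle hcon)
  have hZtop : Z = ⊤ := by
    apply Submodule.map_injective_of_injective X.injective_subtype
    rw [heq, Submodule.map_subtype_top]
  have hsurj : Function.Surjective h := by
    intro x
    obtain ⟨y, hy⟩ := (hZtop ▸ Submodule.mem_top : x ∈ Z)
    exact ⟨(h ^ n) y, by rw [← hy, pow_succ', Module.End.mul_apply]⟩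
  exact IsNoetherian.bijective_of_surjective_endomorphism h hsurj

theorem isComplemented_projective {P : Type*} [AddCommGroup P] [Module Λ P]
    [Module.Projective Λ P] {X : Submodule Λ P} (hX : IsComplemented X) :
    Module.Projective Λ X := by
  obtain ⟨X', h⟩ := hX
  exact Module.Projective.of_split X.subtype (X.projectionOnto X' h)
    (LinearMap.ext fun x => by simp)

/-- The minimal summands behave like projective covers of `S`: lifts in both directions compose to
endomorphisms over `S`, which are bijective. -/
theorem haveCommonSummand_of_comp_ne_zero {P Q : Type w} [AddCommGroup P] [Module Λ P]
    [AddCommGroup Q] [Module Λ Q] [IsNoetherian Λ P] [IsArtinian Λ P] [IsNoetherian Λ Q]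
    [IsArtinian Λ Q] [Module.Projective Λ P] [Module.Projective Λ Q] {S : Type*} [AddCommGroup S]
    [Module Λ S] [IsSimpleModule Λ S] (q : P →ₗ[Λ] S) (q' : Q →ₗ[Λ] S) (hq : q ≠ 0)
    (hq' : q' ≠ 0) : HaveCommonSummand Λ P Q := by
  obtain ⟨X, hX, hqX, hXb⟩ := exists_isComplemented_minimal q hq
  obtain ⟨Y, hY, hqY, hYb⟩ := exists_isComplemented_minimal q' hq'
  have := isComplemented_projective hX
  have := isComplemented_projective hY
  obtain ⟨a, ha⟩ := Module.projective_lifting_property (q'.domRestrict Y) (q.domRestrict X)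
    (LinearMap.surjective_of_ne_zero hqY)
  obtain ⟨b, hb⟩ := Module.projective_lifting_property (q.domRestrict X) (q'.domRestrict Y)
    (LinearMap.surjective_of_ne_zero hqX)
  have h1 := hXb (b ∘ₗ a) (by rw [← LinearMap.comp_assoc, hb, ha])
  have h2 := hYb (a ∘ₗ b) (by rw [← LinearMap.comp_assoc, ha, hb])
  refine ⟨X, Y, ?_, hX, hY, ⟨LinearEquiv.ofBijective a ⟨?_, ?_⟩⟩⟩
  · rintro rfl
    exact hqX (Subsingleton.elim _ _)
  · exact Function.Injective.of_comp (f := b) h1.1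
  · exact Function.Surjective.of_comp (g := b) h2.2

/-- A map from an indecomposable module `M` to a projective module which does not land in the
radical makes `M` projective. -/
theorem IsIndecomposable.projective_of_comp_ne_zero {M Q S : Type*} [AddCommGroup M]
    [Module Λ M] [AddCommGroup Q] [Module Λ Q] [IsNoetherian Λ M] [IsArtinian Λ M]
    [Module.Projective Λ Q] [AddCommGroup S] [Module Λ S] [IsSimpleModule Λ S]
    (hM : IsIndecomposable Λ M) (t : M →ₗ[Λ] Q) (q : Q →ₗ[Λ] S) (h : q ∘ₗ t ≠ 0) :
    Module.Projective Λ M := by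
  obtain ⟨k, hk⟩ := Module.projective_lifting_property (q ∘ₗ t) q (LinearMap.surjective_of_ne_zero h)
  have hpow : ∀ n : ℕ, (q ∘ₗ t) ∘ₗ ((k ∘ₗ t) ^ n : Module.End Λ M) = q ∘ₗ t := by
    intro n
    induction n with
    | zero => rfl
    | succ n ih =>
      rw [pow_succ, Module.End.mul_eq_comp, ← LinearMap.comp_assoc, ih, ← LinearMap.comp_assoc, hk]
  obtain ⟨n, hn⟩ := Filter.eventually_atTop.mp
    (LinearMap.eventually_isCompl_ker_pow_range_pow (M := M) (k ∘ₗ t))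
  -- Again the positive exponent matters: injectivity of the power passes to `k ∘ₗ t`.
  replace hn := hn (n + 1) (by omega)
  have hker : LinearMap.ker ((k ∘ₗ t) ^ (n + 1) : Module.End Λ M) = ⊥ := by
    refine (hM.2 _ _ hn).resolve_right fun h0 => h ?_
    rw [← hpow (n + 1), LinearMap.range_eq_bot.mp h0, LinearMap.comp_zero]
  have hinj : Function.Injective (k ∘ₗ t) := by
    have := LinearMap.ker_eq_bot.mp hker
    rw [pow_succ, Module.End.mul_eq_comp, LinearMap.coe_comp] at this
    exact this.of_comp
  let e := LinearEquiv.ofBijective (k ∘ₗ t)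
    (IsArtinian.bijective_of_injective_endomorphism _ hinj)
  refine Module.Projective.of_split t (e.symm.toLinearMap ∘ₗ k) (LinearMap.ext fun x => ?_)
  exact e.symm_apply_apply x

/-- Over a semiprimary ring the radical of a module `M` is `rad Λ • M`. -/
theorem jacobson_eq_jacobson_smul_top [IsSemiprimaryRing Λ] (M : Type*) [AddCommGroup M]
    [Module Λ M] : Module.jacobson Λ M = Ring.jacobson Λ • (⊤ : Submodule Λ M) := by
  refine le_antisymm (Module.jacobson_le_of_eq_bot ?_) (Ring.jacobson_smul_top_le Λ M)
  have h : Module.IsTorsionBySet Λ (M ⧸ Ring.jacobson Λ • (⊤ : Submodule Λ M))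
      (Ring.jacobson Λ : Set Λ) :=
    (Module.isTorsionBySet_quotient_iff _ _).mpr fun m a ha => Submodule.smul_mem_smul ha trivial
  -- The quotient is a module over the semisimple ring `Λ / rad Λ`, so its radical is zero.
  let _ := h.module
  have := (h.semilinearMap.isSemisimpleModule_iff_of_bijective Function.bijective_id).2
    inferInstance
  exact IsSemisimpleModule.jacobson_eq_bot _ _

/-- A map which does not land in the radical is nonzero modulo a maximal submodule. -/
theorem exists_isCoatom_mkQ_comp_ne_zero [IsSemiprimaryRing Λ] {M Q : Type*} [AddCommGroup M]
    [Module Λ M] [AddCommGroup Q] [Module Λ Q] (t : M →ₗ[Λ] Q) (m : M)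
    (h : t m ∉ Ring.jacobson Λ • (⊤ : Submodule Λ Q)) :
    ∃ N : Submodule Λ Q, IsCoatom N ∧ N.mkQ ∘ₗ t ≠ 0 := by
  rw [← jacobson_eq_jacobson_smul_top, Module.jacobson, Submodule.mem_sInf] at h
  push Not at h
  obtain ⟨N, hN, hm⟩ := h
  refine ⟨N, hN, fun h0 => hm ?_⟩
  have := LinearMap.congr_fun h0 m
  simpa using this

theorem haveCommonSummand_of_notMem_jacobson_smul_top [IsArtinianRing Λ] {P Q : Type w}
    [AddCommGroup P] [Module Λ P] [AddCommGroup Q] [Module Λ Q] [Module.Finite Λ P]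
    [Module.Finite Λ Q] [Module.Projective Λ P] [Module.Projective Λ Q] (s : Q →ₗ[Λ] P) (y : Q)
    (h : s y ∉ Ring.jacobson Λ • (⊤ : Submodule Λ P)) : HaveCommonSummand Λ P Q := by
  obtain ⟨N, hN, hs⟩ := exists_isCoatom_mkQ_comp_ne_zero s y h
  have : IsSimpleModule Λ (P ⧸ N) := isSimpleModule_iff_isCoatom.mpr hN
  refine haveCommonSummand_of_comp_ne_zero N.mkQ (N.mkQ ∘ₗ s) (fun h0 => hs ?_) hs
  rw [h0, LinearMap.zero_comp]

theorem IsIndecomposable.mem_jacobson_smul_top [IsArtinianRing Λ] {M Q : Type*}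
    [AddCommGroup M] [Module Λ M] [Module.Finite Λ M] [AddCommGroup Q] [Module Λ Q]
    [Module.Projective Λ Q] (hM : IsIndecomposable Λ M) (hM' : ¬ Module.Projective Λ M)
    (t : M →ₗ[Λ] Q) (m : M) : t m ∈ Ring.jacobson Λ • (⊤ : Submodule Λ Q) := by
  by_contra h
  obtain ⟨N, hN, ht⟩ := exists_isCoatom_mkQ_comp_ne_zero t m h
  have : IsSimpleModule Λ (Q ⧸ N) := isSimpleModule_iff_isCoatom.mpr hN
  exact hM' (hM.projective_of_comp_ne_zero t N.mkQ ht)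

end FiniteLength

/-! ### Superfluous submodules -/

section Superfluous

variable {Λ : Type*} [Ring Λ]

theorem IsSuperfluous.map {P Q : Type*} [AddCommGroup P] [Module Λ P] [AddCommGroup Q]
    [Module Λ Q] {N : Submodule Λ P} (hN : IsSuperfluous N) (f : P →ₗ[Λ] Q) :
    IsSuperfluous (N.map f) := by
  intro X hX
  have h : N ⊔ X.comap f = ⊤ := by
    rw [eq_top_iff]
    intro x _
    obtain ⟨_, ⟨n, hn, rfl⟩, z, hz, hx⟩ :=
      Submodule.mem_sup.mp (hX ▸ Submodule.mem_top : f x ∈ N.map f ⊔ X)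
    refine Submodule.mem_sup.mpr ⟨n, hn, x - n, ?_, by abel⟩
    rw [Submodule.mem_comap, map_sub, ← hx, add_sub_cancel_left]
    exact hz
  have h' := hN _ h
  rw [← hX, eq_comm, sup_eq_right]
  rintro _ ⟨n, -, rfl⟩
  exact (h' ▸ Submodule.mem_top : n ∈ X.comap f)

theorem IsSuperfluous.sup {P : Type*} [AddCommGroup P] [Module Λ P] {N N' : Submodule Λ P}
    (hN : IsSuperfluous N) (hN' : IsSuperfluous N') : IsSuperfluous (N ⊔ N') :=
  fun X hX => hN' X (hN _ (by rw [← sup_assoc, hX]))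

theorem IsSuperfluous.mono {P : Type*} [AddCommGroup P] [Module Λ P] {N N' : Submodule Λ P}
    (h : N ≤ N') (hN' : IsSuperfluous N') : IsSuperfluous N :=
  fun X hX => hN' X (eq_top_iff.mpr (hX ▸ sup_le_sup_right h X))

theorem IsSuperfluous.eq_bot_of_isComplemented {P : Type*} [AddCommGroup P] [Module Λ P]
    {N : Submodule Λ P} (hN : IsSuperfluous N) (h : IsComplemented N) : N = ⊥ := by
  obtain ⟨X, hX⟩ := h
  have := hN X hX.sup_eq_top
  subst this
  simpa using hX.inf_eq_bot

theorem surjective_of_comp_surjective_of_isSuperfluous {P Q M : Type*} [AddCommGroup P]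
    [Module Λ P] [AddCommGroup Q] [Module Λ Q] [AddCommGroup M] [Module Λ M] (π : P →ₗ[Λ] M)
    (hπ : IsSuperfluous (LinearMap.ker π)) (f : Q →ₗ[Λ] P)
    (h : LinearMap.range π ≤ LinearMap.range (π ∘ₗ f)) : Function.Surjective f := by
  rw [← LinearMap.range_eq_top]
  apply hπ
  rw [eq_top_iff]
  intro x _
  obtain ⟨z, hz⟩ := h ⟨x, rfl⟩
  refine Submodule.mem_sup.mpr ⟨x - f z, ?_, f z, ⟨z, rfl⟩, by abel⟩
  rw [LinearMap.mem_ker, map_sub, ← hz, LinearMap.comp_apply, sub_self]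

end Superfluous

end ArtinAlg

namespace ArtinAlg

/-! ### The cogenerator `I` -/

section Cogenerator

/-- The injective envelope of `R / rad R` is a cogenerator. -/
theorem IsInjectiveEnvelope.exists_apply_ne_zero {R : Type u} [CommRing R] [IsArtinianRing R]
    {I : Type u} [AddCommGroup I] [Module R I]
    (hI : IsInjectiveEnvelope R (R ⧸ Ring.jacobson R) I) {X : Type*} [AddCommGroup X] [Module R X]
    (x : X) (hx : x ≠ 0) : ∃ φ : X →ₗ[R] I, φ x ≠ 0 := by
  obtain ⟨hinj, ι, hι, -⟩ := hI
  have hne : Ideal.torsionOf R X x ≠ ⊤ := fun h => hx ((Ideal.torsionOf_eq_top_iff R x).mp h)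
  obtain ⟨m, hm, hle⟩ := Ideal.exists_le_maximal _ hne
  have hJ : Ring.jacobson R ≤ m := Ring.jacobson_le_of_isMaximal m
  have : IsSemisimpleModule R (R ⧸ Ring.jacobson R) :=
    (IsArtinian.isSemisimpleModule_iff_jacobson R _).mpr (Module.jacobson_quotient_jacobson R R)
  -- Semisimplicity of `R / rad R` embeds its simple quotient `R / m` back into it, hence into `I`.
  obtain ⟨σ, hσ⟩ := IsSemisimpleModule.lifting_property (Submodule.factor hJ)
    (Submodule.factor_surjective hJ) (LinearMap.id : (R ⧸ m) →ₗ[R] R ⧸ m)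
  let ψ : (R ∙ x) →ₗ[R] I := (ι ∘ₗ σ ∘ₗ Submodule.factor hle) ∘ₗ
    (Ideal.quotTorsionOfEquivSpanSingleton R X x).symm.toLinearMap
  obtain ⟨φ, hφ⟩ := (Module.Baer.of_injective hinj).extension_property (R ∙ x).subtype
    (Submodule.injective_subtype _) ψ
  refine ⟨φ, fun h0 => ?_⟩
  have h1 : ψ ⟨x, Submodule.mem_span_singleton_self x⟩ = 0 := by
    rw [← hφ]
    exact h0
  have h2 : (Ideal.quotTorsionOfEquivSpanSingleton R X x).symm
      ⟨x, Submodule.mem_span_singleton_self x⟩ = Submodule.Quotient.mk 1 := by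
    rw [LinearEquiv.symm_apply_eq, Ideal.quotTorsionOfEquivSpanSingleton_apply_mk, one_smul]
  have h3 : ι (σ (Submodule.Quotient.mk 1)) = 0 := by
    have h4 : ψ ⟨x, Submodule.mem_span_singleton_self x⟩ =
      ι (σ (Submodule.factor hle ((Ideal.quotTorsionOfEquivSpanSingleton R X x).symm
      ⟨x, Submodule.mem_span_singleton_self x⟩))) := rfl
    rw [h4, h2] at h1
    exact h1
  have h5 : σ (Submodule.Quotient.mk 1) = 0 := hι (h3.trans (map_zero ι).symm)
  have h6 : (Submodule.Quotient.mk 1 : R ⧸ m) = 0 := by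
    have := LinearMap.congr_fun hσ (Submodule.Quotient.mk 1)
    rw [LinearMap.comp_apply, h5, map_zero] at this
    exact this.symm
  exact hm.ne_top ((Ideal.eq_top_iff_one m).mpr ((Submodule.Quotient.mk_eq_zero m).mp h6))

end Cogenerator

/-! ### Minimal projective presentations -/

section Presentation

variable {Λ : Type v} [Ring Λ] {M : Type w} [AddCommGroup M] [Module Λ M]

theorem MinProjPres.π_comp_d (p : MinProjPres Λ M) : p.π ∘ₗ p.d = 0 :=
  LinearMap.range_le_ker_iff.mp p.exact.le

/-- Every map of modules lifts to a map of minimal projective presentations. -/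
theorem MinProjPres.exists_lift {N : Type*} [AddCommGroup N] [Module Λ N] (p : MinProjPres Λ M)
    (q : MinProjPres Λ N) (f : M →ₗ[Λ] N) :
    ∃ (f₀ : p.P₀ →ₗ[Λ] q.P₀) (f₁ : p.P₁ →ₗ[Λ] q.P₁),
      q.π ∘ₗ f₀ = f ∘ₗ p.π ∧ q.d ∘ₗ f₁ = f₀ ∘ₗ p.d := by
  obtain ⟨f₀, h₀⟩ := Module.projective_lifting_property q.π (f ∘ₗ p.π) q.surjective_π
  obtain ⟨f₁, h₁⟩ := exists_comp_eq_of_range_le q.d (f₀ ∘ₗ p.d) (by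
    rw [q.exact, LinearMap.range_le_ker_iff, ← LinearMap.comp_assoc, h₀, LinearMap.comp_assoc,
      p.π_comp_d, LinearMap.comp_zero])
  exact ⟨f₀, f₁, h₀, h₁⟩

/-- Every map `P₁ → M` factors through `d : P₁ → P₀`. -/
def MinProjPres.FactorsThrough (p : MinProjPres Λ M) : Prop :=
  ∀ f : p.P₁ →ₗ[Λ] M, ∃ h : p.P₀ →ₗ[Λ] M, h ∘ₗ p.d = f

/-- Needed because `IsTauRigid` supplies its own presentation. Minimality makes the round trip on
`P₁` an automorphism, even though the comparison maps are only lifts of the identity. -/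
theorem MinProjPres.FactorsThrough.of_minProjPres [IsNoetherianRing Λ] {p' : MinProjPres Λ M}
    (h' : p'.FactorsThrough) (p : MinProjPres Λ M) : p.FactorsThrough := by
  intro f
  obtain ⟨a₀, a₁, ha₀, ha₁⟩ := p.exists_lift p' LinearMap.id
  obtain ⟨b₀, b₁, hb₀, hb₁⟩ := p'.exists_lift p LinearMap.id
  rw [LinearMap.id_comp] at ha₀ hb₀
  have hπ : p.π ∘ₗ (b₀ ∘ₗ a₀) = p.π := by rw [← LinearMap.comp_assoc, hb₀, ha₀]
  have hd : p.d ∘ₗ (b₁ ∘ₗ a₁) = (b₀ ∘ₗ a₀) ∘ₗ p.d := by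
    rw [← LinearMap.comp_assoc, hb₁, LinearMap.comp_assoc, ha₁, LinearMap.comp_assoc]
  have hs₀ := surjective_of_comp_surjective_of_isSuperfluous p.π p.superfluous_ker_π (b₀ ∘ₗ a₀)
    (by rw [hπ])
  have hs₁ := surjective_of_comp_surjective_of_isSuperfluous p.d p.superfluous_ker_d (b₁ ∘ₗ a₁) (by
    rw [hd, LinearMap.range_comp, p.exact]
    intro x hx
    obtain ⟨z, rfl⟩ := hs₀ x
    refine Submodule.mem_map_of_mem ?_
    rwa [LinearMap.mem_ker, ← LinearMap.comp_apply, hπ] at hx)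
  let e := LinearEquiv.ofBijective (b₁ ∘ₗ a₁)
    (IsNoetherian.bijective_of_surjective_endomorphism _ hs₁)
  obtain ⟨h, hh⟩ := h' (f ∘ₗ e.symm.toLinearMap ∘ₗ b₁)
  refine ⟨h ∘ₗ a₀, ?_⟩
  rw [LinearMap.comp_assoc, ← ha₁, ← LinearMap.comp_assoc, hh]
  exact LinearMap.ext fun x => congrArg f (e.symm_apply_apply x)

theorem MinProjPres.FactorsThrough.not_haveCommonSummand {p : MinProjPres Λ M}
    (h : p.FactorsThrough) : ¬ HaveCommonSummand Λ p.P₀ p.P₁ := by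
  rintro ⟨X, Y, hX0, hX, ⟨Y', hY⟩, ⟨e⟩⟩
  let s : p.P₁ →ₗ[Λ] p.P₀ := X.subtype ∘ₗ e.symm.toLinearMap ∘ₗ Y.projectionOnto Y' hY
  obtain ⟨k, hk⟩ := h (p.π ∘ₗ s)
  obtain ⟨k₀, hk₀⟩ := Module.projective_lifting_property p.π k p.surjective_π
  -- Thus `s = k₀ d + d g` has image in the superfluous `k₀(range d) + range d`, while that image
  -- contains the summand `X`.
  obtain ⟨g, hg⟩ := exists_comp_eq_of_range_le p.d (s - k₀ ∘ₗ p.d) (by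
    rw [p.exact, LinearMap.range_le_ker_iff, LinearMap.comp_sub, ← hk, ← hk₀,
      LinearMap.comp_assoc, sub_self])
  have hsup : IsSuperfluous (LinearMap.range p.d) := p.exact ▸ p.superfluous_ker_π
  refine hX0 ((IsSuperfluous.mono ?_ ((hsup.map k₀).sup hsup)).eq_bot_of_isComplemented hX)
  intro x hx
  have hx' : s (e ⟨x, hx⟩) = x := by simp [s]
  have hsum : s (e ⟨x, hx⟩) = k₀ (p.d (e ⟨x, hx⟩)) + p.d (g (e ⟨x, hx⟩)) := by
    have : p.d (g (e ⟨x, hx⟩)) = s (e ⟨x, hx⟩) - k₀ (p.d (e ⟨x, hx⟩)) :=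
      LinearMap.congr_fun hg (e ⟨x, hx⟩ : p.P₁)
    rw [this, add_sub_cancel]
  rw [← hx', hsum]
  exact Submodule.add_mem_sup (Submodule.mem_map_of_mem ⟨_, rfl⟩) ⟨_, rfl⟩

end Presentation

/-! ### Transpose, duality and τ-rigidity -/

section Rigidity

variable {R : Type u} [CommRing R] {Λ : Type v} [Ring Λ] [Algebra R Λ]
  {I : Type u} [AddCommGroup I] [Module R I]

/-- An element of the dual, as an `R`-linear map. -/
def Dual.toLinearMap {X : Type w} [AddCommGroup X] [Module R X] [Module Λᵐᵒᵖ X]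
    [IsScalarTower R Λᵐᵒᵖ X] (φ : Dual R Λ I X) : X →ₗ[R] I := φ

theorem Dual.smul_toLinearMap_apply {X : Type w} [AddCommGroup X] [Module R X] [Module Λᵐᵒᵖ X]
    [IsScalarTower R Λᵐᵒᵖ X] (a : Λ) (φ : Dual R Λ I X) (x : X) :
    (a • φ).toLinearMap x = φ.toLinearMap (MulOpposite.op a • x) := rfl

/-- The map on duals induced by a map of right `Λ`-modules. -/
def Dual.map {X Y : Type w} [AddCommGroup X] [Module R X] [Module Λᵐᵒᵖ X]
    [IsScalarTower R Λᵐᵒᵖ X] [AddCommGroup Y] [Module R Y] [Module Λᵐᵒᵖ Y]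
    [IsScalarTower R Λᵐᵒᵖ Y] (f : X →ₗ[Λᵐᵒᵖ] Y) : Dual R Λ I Y →ₗ[Λ] Dual R Λ I X where
  toFun φ := φ.toLinearMap ∘ₗ f.restrictScalars R
  map_add' _ _ := rfl
  map_smul' a φ := LinearMap.ext fun x =>
    congrArg φ.toLinearMap (map_smul f (MulOpposite.op a) x).symm

variable {M : Type w} [AddCommGroup M] [Module Λ M]

theorem MinProjPres.factorsThrough_of_forall_eq_zero [IsArtinianRing R]
    (hI : IsInjectiveEnvelope R (R ⧸ Ring.jacobson R) I) (p : MinProjPres Λ M)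
    (hp : ∀ f : M →ₗ[Λ] p.tau R I, f = 0) : p.FactorsThrough := by
  intro u
  let _ : Module R M := Module.compHom M (algebraMap R Λ)
  have : IsScalarTower R Λ M := IsScalarTower.of_algebraMap_smul fun _ _ => rfl
  have : SMulCommClass Λ R M := IsScalarTower.to_smulCommClass'
  let C : Submodule R (p.P₁ →ₗ[Λ] M) :=
    { carrier := {f | ∃ h : p.P₀ →ₗ[Λ] M, h ∘ₗ p.d = f}
      add_mem' := by
        rintro _ _ ⟨h, rfl⟩ ⟨k, rfl⟩
        exact ⟨h + k, LinearMap.add_comp _ _ _⟩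
      zero_mem' := ⟨0, LinearMap.zero_comp _⟩
      smul_mem' := by
        rintro c _ ⟨h, rfl⟩
        exact ⟨c • h, rfl⟩ }
  by_contra hu
  obtain ⟨φ, hφ⟩ := hI.exists_apply_ne_zero (C.mkQ u)
    (fun h => hu ((Submodule.Quotient.mk_eq_zero C).mp h))
  apply hφ
  let ev (m : M) : (p.P₁ →ₗ[Λ] Λ) →ₗ[R] (p.P₁ →ₗ[Λ] M) :=
    { toFun := fun g => LinearMap.toSpanSingleton Λ M m ∘ₗ g
      map_add' := fun _ _ => LinearMap.comp_add _ _ _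
      map_smul' := fun c g => LinearMap.ext fun y => smul_assoc c (g y) m }
  let F : M →ₗ[Λ] p.tau R I :=
    { toFun := fun m => (((LinearMap.range (starMap p.d)).restrictScalars R).liftQ
        (φ ∘ₗ C.mkQ ∘ₗ ev m) (by
          rintro _ ⟨a, rfl⟩
          have hmem : ev m (starMap p.d a) ∈ C := ⟨LinearMap.toSpanSingleton Λ M m ∘ₗ a, rfl⟩
          rw [LinearMap.mem_ker, LinearMap.comp_apply, LinearMap.comp_apply, Submodule.mkQ_apply,
            (Submodule.Quotient.mk_eq_zero C).mpr hmem, map_zero]) : _ →ₗ[R] I)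
      map_add' := fun m n => by
        refine LinearMap.ext fun x => ?_
        obtain ⟨g, rfl⟩ := Submodule.Quotient.mk_surjective _ x
        change φ (C.mkQ (ev (m + n) g)) = φ (C.mkQ (ev m g)) + φ (C.mkQ (ev n g))
        rw [← map_add, ← map_add]
        congr 2
        exact LinearMap.ext fun y => smul_add (g y) m n
      map_smul' := fun a m => by
        refine LinearMap.ext fun x => ?_
        obtain ⟨g, rfl⟩ := Submodule.Quotient.mk_surjective _ x
        change φ (C.mkQ (ev (a • m) g)) = φ (C.mkQ (ev m (MulOpposite.op a • g)))
        congr 2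
        exact LinearMap.ext fun y => smul_smul (g y) a m }
  have hF : ∀ m g, φ (C.mkQ (ev m g)) = 0 := fun m g => by
    have h1 : (F m).toLinearMap (Submodule.Quotient.mk g) = 0 := by
      rw [hp F]
      rfl
    exact h1
  obtain ⟨n, g, y, hgy⟩ := exists_dualBasis (Λ := Λ) p.P₁
  -- The dual basis writes `u` through maps `P₁ → Λ → M`, on which `φ` vanishes.
  have hu : u = ∑ i, ev (u (y i)) (g i) := by
    refine LinearMap.ext fun x => ?_
    conv_lhs => rw [← hgy x]
    simp [ev, LinearMap.sum_apply]
  rw [hu, map_sum, map_sum]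
  exact Finset.sum_eq_zero fun i _ => hF _ _

/-- If there are no nonzero maps `τ M → τ N`, so that `τ f = 0` for every `f : M → N`, then every
`f : M → N` factors through the projective cover of `N`. -/
theorem MinProjPres.exists_π_comp_eq [IsArtinianRing R]
    (hI : IsInjectiveEnvelope R (R ⧸ Ring.jacobson R) I) {N : Type*} [AddCommGroup N] [Module Λ N]
    (p : MinProjPres Λ M) (q : MinProjPres Λ N)
    (hpq : ∀ f : p.tau R I →ₗ[Λ] q.tau R I, f = 0) (f : M →ₗ[Λ] N) :
    ∃ t : M →ₗ[Λ] q.P₀, q.π ∘ₗ t = f := by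
  obtain ⟨f₀, f₁, h₀, h₁⟩ := p.exists_lift q f
  let F : q.Tr →ₗ[Λᵐᵒᵖ] p.Tr := Submodule.mapQ _ _ (starMap f₁) (by
    rintro _ ⟨a, rfl⟩
    refine ⟨a ∘ₗ f₀, ?_⟩
    change (a ∘ₗ f₀) ∘ₗ p.d = (a ∘ₗ q.d) ∘ₗ f₁
    rw [LinearMap.comp_assoc, LinearMap.comp_assoc, h₁])
  have hF : ∀ x, F x = 0 := by
    intro x
    by_contra hx
    obtain ⟨φ, hφ⟩ := hI.exists_apply_ne_zero (F x) hx
    apply hφ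
    have h2 : (Dual.map (R := R) (I := I) F φ).toLinearMap x = 0 := by
      rw [hpq (Dual.map F)]
      rfl
    exact h2
  have hex : ∀ g : q.P₁ →ₗ[Λ] Λ, ∃ a : p.P₀ →ₗ[Λ] Λ, a ∘ₗ p.d = g ∘ₗ f₁ := fun g =>
    (Submodule.Quotient.mk_eq_zero (LinearMap.range (starMap p.d))).mp
      (hF (Submodule.Quotient.mk g))
  obtain ⟨n, g, y, hgy⟩ := exists_dualBasis (Λ := Λ) q.P₁
  choose a ha using fun i => hex (g i)
  -- Each `g i ∘ₗ f₁` extends along `p.d`; the dual basis glues the extensions into a homotopy `s`,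
  -- and `f₀ - q.d ∘ₗ s` descends to `M`.
  let s : p.P₀ →ₗ[Λ] q.P₁ := ∑ i, LinearMap.toSpanSingleton Λ q.P₁ (y i) ∘ₗ a i
  have hs : s ∘ₗ p.d = f₁ := by
    refine LinearMap.ext fun x => ?_
    rw [← hgy (f₁ x)]
    simp only [s, LinearMap.comp_apply, LinearMap.sum_apply, LinearMap.toSpanSingleton_apply]
    exact Finset.sum_congr rfl fun i _ => congrArg (· • y i) (LinearMap.congr_fun (ha i) x)
  have hker : LinearMap.ker p.π ≤ LinearMap.ker (f₀ - q.d ∘ₗ s) := by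
    rw [← p.exact, LinearMap.range_le_ker_iff, LinearMap.sub_comp, LinearMap.comp_assoc, hs, h₁,
      sub_self]
  let t := (LinearMap.ker p.π).liftQ (f₀ - q.d ∘ₗ s) hker ∘ₗ
    (p.π.quotKerEquivOfSurjective p.surjective_π).symm.toLinearMap
  have ht : ∀ x, t (p.π x) = f₀ x - q.d (s x) := by
    intro x
    have : (p.π.quotKerEquivOfSurjective p.surjective_π).symm (p.π x) = Submodule.Quotient.mk x := by
      rw [LinearEquiv.symm_apply_eq]
      rfl
    simp only [t, LinearMap.comp_apply, LinearEquiv.coe_coe, this]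
    rfl
  refine ⟨t, LinearMap.ext fun m => ?_⟩
  obtain ⟨x, rfl⟩ := p.surjective_π m
  rw [LinearMap.comp_apply, ht, map_sub, ← LinearMap.comp_apply q.π q.d, q.π_comp_d,
    LinearMap.zero_apply, sub_zero]
  exact LinearMap.congr_fun h₀ x

/-- A section of a projective cover is onto, so `π` is injective and `d = 0`; its kernel, all of
`P₁`, is superfluous only if `P₁ = 0`. -/
theorem MinProjPres.subsingleton_P₁ [Module.Projective Λ M] (p : MinProjPres Λ M) :
    Subsingleton p.P₁ := by
  obtain ⟨σ, hσ⟩ := Module.projective_lifting_property p.π LinearMap.id p.surjective_π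
  have hsurj := surjective_of_comp_surjective_of_isSuperfluous p.π p.superfluous_ker_π σ
    (by rw [hσ, LinearMap.range_id]; exact le_top)
  have hker : LinearMap.ker p.π = ⊥ := LinearMap.ker_eq_bot.mpr
    (Function.LeftInverse.rightInverse_of_surjective (f := p.π) (g := σ)
      (LinearMap.congr_fun hσ) hsurj).injective
  have hd : LinearMap.ker p.d = ⊤ := by
    rw [LinearMap.ker_eq_top, ← LinearMap.range_eq_bot, p.exact, hker]
  have := p.superfluous_ker_d ⊥ (by rw [hd, top_sup_eq])
  exact (Submodule.subsingleton_iff Λ).mp (subsingleton_of_bot_eq_top this)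

/-- If `P₀` and `P₁` have no common summand, then a map `M → τ M` that kills `rad M` is zero. -/
theorem MinProjPres.eq_zero_of_jacobson_smul [IsArtinianRing Λ] (p : MinProjPres Λ M)
    (hp : ¬ HaveCommonSummand Λ p.P₀ p.P₁) (f : M →ₗ[Λ] p.tau R I)
    (hf : ∀ a ∈ Ring.jacobson Λ, ∀ m, a • f m = 0) : f = 0 := by
  have hrad : Ring.jacobson Λ • (⊤ : Submodule Λ p.P₀) ≤ LinearMap.ker (f ∘ₗ p.π) := by
    rw [Submodule.smul_le]
    intro a ha x _
    rw [LinearMap.mem_ker, map_smul]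
    exact hf a ha _
  obtain ⟨n, g, y, hgy⟩ := exists_dualBasis (Λ := Λ) p.P₁
  refine LinearMap.ext fun m => ?_
  obtain ⟨x, rfl⟩ := p.surjective_π m
  refine LinearMap.ext fun z => ?_
  obtain ⟨k, rfl⟩ := Submodule.Quotient.mk_surjective _ z
  have hk : k = ∑ i, MulOpposite.op (k (y i)) • g i := by
    refine LinearMap.ext fun b => ?_
    conv_lhs => rw [← hgy b]
    simp [LinearMap.sum_apply]
  have hterm : ∀ i, (f (p.π x)).toLinearMap
      (Submodule.Quotient.mk (MulOpposite.op (k (y i)) • g i)) = 0 := by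
    intro i
    -- The map `b ↦ k b • x` from `P₁` to `P₀` must land in the radical.
    have h1 : k (y i) • x ∈ Ring.jacobson Λ • (⊤ : Submodule Λ p.P₀) := by
      by_contra hcon
      exact hp (haveCommonSummand_of_notMem_jacobson_smul_top
        (LinearMap.toSpanSingleton Λ p.P₀ x ∘ₗ k) (y i) hcon)
    have h2 : k (y i) • f (p.π x) = 0 := by
      rw [← map_smul, ← map_smul]
      exact hrad h1
    rw [Submodule.Quotient.mk_smul, ← Dual.smul_toLinearMap_apply, h2]
    rfl
  change (f (p.π x)).toLinearMap (Submodule.mkQ _ k) = 0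
  rw [hk, map_sum, map_sum]
  exact Finset.sum_eq_zero fun i _ => hterm i

end Rigidity

end ArtinAlg

/-! ### The equivalence -/

theorem theorem3p15 {R : Type u} [CommRing R] [IsArtinianRing R]
    {Λ : Type v} [Ring Λ] [Algebra R Λ] [Module.Finite R Λ]
    (hΛ : ArtinAlg.RadicalSquareZero Λ)
    {I : Type u} [AddCommGroup I] [Module R I]
    (hI : ArtinAlg.IsInjectiveEnvelope R (R ⧸ Ring.jacobson R) I)
    {M : Type w} [AddCommGroup M] [Module Λ M] [Module.Finite Λ M]
    (hM : ArtinAlg.IsIndecomposable Λ M)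
    (p : ArtinAlg.MinProjPres Λ M)
    (hτ : ArtinAlg.IsTauRigid R I Λ (p.tau R I)) :
    ArtinAlg.IsTauRigid R I Λ M ↔ ¬ ArtinAlg.HaveCommonSummand Λ p.P₀ p.P₁ := by
  have : IsArtinianRing Λ := IsArtinianRing.of_finite R Λ
  constructor
  · rintro ⟨p', hp'⟩
    exact ((p'.factorsThrough_of_forall_eq_zero hI hp').of_minProjPres p).not_haveCommonSummand
  · intro hp
    refine ⟨p, fun f => ?_⟩
    by_cases hproj : Module.Projective Λ M
    · have := p.subsingleton_P₁
      have : Subsingleton (p.P₁ →ₗ[Λ] Λ) := ⟨fun g h => LinearMap.ext fun x => by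
        rw [Subsingleton.elim x 0, map_zero, map_zero]⟩
      refine LinearMap.ext fun m => LinearMap.ext fun z => ?_
      obtain ⟨k, rfl⟩ := Submodule.Quotient.mk_surjective _ z
      rw [Subsingleton.elim k 0]
      exact (f m).toLinearMap.map_zero
    · obtain ⟨q, hq⟩ := hτ
      obtain ⟨t, rfl⟩ := p.exists_π_comp_eq hI q hq f
      refine p.eq_zero_of_jacobson_smul hp _ fun a ha m => ?_
      have hz : ∀ z ∈ Ring.jacobson Λ • (⊤ : Submodule Λ q.P₀), a • z = 0 := fun z hz => by
        induction hz using Submodule.smul_induction_on' with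
        | smul b hb z _ => rw [smul_smul, hΛ a ha b hb, zero_smul]
        | add x _ y _ hx hy => rw [smul_add, hx, hy, add_zero]
      rw [LinearMap.comp_apply, ← map_smul, hz _ (hM.mem_jacobson_smul_top hproj t m), map_zero]
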